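/- **Setting.** Let $(a_{ij})_{i,j\in I}$ be a symmetrizable generalized Cartan matrix with finite index set $I$, let $(d_i)_{i\in I}$ be relatively prime positive integers such that $(d_ia_{ij})$ is symmetric, and let $(\cdot,\cdot)$ be the bilinear form on $Q=\bigoplus_{i}\mathbb Z\alpha_i$ with $(\alpha_i,\alpha_j)=d_ia_{ij}$. Let $\tau:I\to I$ be an involutive bijection with $a_{\tau(i)\tau(j)}=a_{ij}$ and $d_{\tau(i)}=d_i$ for all $i,j$. Let $\mathbb K$ be a field of characteristic zero, $q\in\mathbb K^\times$ with $q^{2d_i}\neq1$ for all $i$, put $q_i=q^{d_i}$, and let $c_i\in\mathbb K^\times$ $(i\in I)$ satisfy $c_i=c_{\tau(i)}$ whenever $a_{i\tau(i)}=0$. Let $T(V^-)$ be the free $\mathbb K$-algebra on generators $F_i$ $(i\in I)$, and let $H_\theta$ be the group algebra of the group of elements $K_\beta$, $\beta\in Q_\theta$, where $Q_\theta\subseteq Q$ is the subgroup generated by all $\alpha_i-\alpha_{\tau(i)}$ (so $K_{\alpha_i-\alpha_{\tau(i)}}=K_iK_{\tau(i)}^{-1}$). The algebra $H_\theta\ltimes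 T(V^-)$ is $T(V^-)\otimes H_\theta$ as a vector space, with $K_\beta F_i=q^{-(\beta,\alpha_i)}F_iK_\beta$. Let $\partial_i^L:T(V^-)\to T(V^-)$ be the linear map with $\partial_i^L(F_j)=\delta_{ij}$ and $\partial_i^L(fg)=\partial_i^L(f)g+q^{(\alpha_i,\mu)}f\,\partial_i^L(g)$ for $f$ of degree $-\mu$ (where $F_j$ has degree $-\alpha_j$). The star product $\circledast$ is the unique associative bilinear product on $H_\theta\ltimes T(V^-)$ such that $h\circledast u=hu$ and $u\circledast h=uh$ for $h\in H_\theta$, $u\in H_\theta\ltimes T(V^-)$, and $$F_i\circledast g=F_ig-\frac{c_iq^{(\alpha_i,\alpha_{\tau(i)})}}{q_i-q_i^{-1}}K_{\tau(i)}K_i^{-1}\partial^L_{\tau(i)}(g)\qquad(i\in I,\ g\in T(V^-)).$$ For $w(x,y)=\sum_{r,s}b_{rs}x^ry^s\in\mathbb K[x,y]$ write $u_3\curvearrowright w(u_1\stackrel{\circledast}{,}u_2)=\sum_{r,s}b_{rs}\,u_1^{\circledast r}\circledast u_3\circledast u_2^{\circledast s}$. For parameters $q',r$ in a commutative ring, the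 bivariate continuous $q'$-Hermite polynomials $H_{m,n}(x,y;q',r)$, $m,n\ge0$, are the unique family of polynomials with $H_{0,0}=1$, $H_{m,n}(x,y;q',r)=H_{n,m}(y,x;q',r)$ and $$2xH_{m,n}=H_{m+1,n}+(1-q'^m)H_{m-1,n}+q'^m(1-q'^n)\,r\,H_{m,n-1},$$ where terms with a negative index are zero. **Proposition.** Let $i,j\in I$ with $\tau(i)=i\neq j$. For all $m,n\ge0$ there is a unique polynomial $w_{m,n}(x,y)\in\mathbb K[x,y]$ with $$F_i^mF_jF_i^n=F_j\curvearrowright w_{m,n}(F_i\stackrel{\circledast}{,}F_i).$$ It is given by $$w_{m,n}(x,y)=\frac{H_{m,n}(b_ix,b_iy;q_i^2,q_i^{a_{ij}})}{(2b_i)^{m+n}},\qquad b_i=\tfrac12(q_i-q_i^{-1})\,c_i^{-1/2}q_i^{-1/2},$$ an identity in $L[x,y]$ for every extension field $L$ of $\mathbb K$ that contains a square root $c_i^{1/2}q_i^{1/2}$ of $c_iq_i$, and for either choice of that square root. -/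

import Mathlib

noncomputable section

/-! ### Bivariate continuous `q`-Hermite polynomials

Polynomials in `x, y` are elements of `MvPolynomial (Fin 2) R` with `x = X 0` and `y = X 1`. -/

section QHermite

open MvPolynomial

variable {R : Type*} [CommRing R]

/-- The defining property of the family `H_{m,n}(x,y;q,r)`: normalisation, symmetry, and the
three-term recursion `2x H_{m,n} = H_{m+1,n} + (1-q^m) H_{m-1,n} + q^m (1-q^n) r H_{m,n-1}`.
Terms with a negative index count as zero; here such a term has coefficient `1 - q^0 = 0`, so that
the truncated subtraction on `ℕ` is harmless. -/
structure IsBivariateQHermite (q r : R) (H : ℕ → ℕ → MvPolynomial (Fin 2) R) : Prop where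
  zero_zero : H 0 0 = 1
  symm : ∀ m n, H m n = rename (Equiv.swap 0 1) (H n m)
  recursion : ∀ m n, 2 * X 0 * H m n =
    H (m + 1) n + C (1 - q ^ m) * H (m - 1) n + C (q ^ m * (1 - q ^ n) * r) * H m (n - 1)

/-- The continuous `q`-Hermite polynomials in the second variable `y`:
`H_{n+1}(y;q) = 2y H_n(y;q) - (1-q^n) H_{n-1}(y;q)`. -/
def qHermiteY (q : R) : ℕ → MvPolynomial (Fin 2) R
  | 0 => 1
  | 1 => 2 * X 1
  | n + 2 => 2 * X 1 * qHermiteY q (n + 1) - C (1 - q ^ (n + 1)) * qHermiteY q n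

/-- The bivariate continuous `q`-Hermite polynomials `H_{m,n}(x,y;q,r)`, computed by the three-term
recursion from `H_{0,n} = H_n(y;q)`. -/
def bivariateQHermite (q r : R) : ℕ → ℕ → MvPolynomial (Fin 2) R
  | 0, n => qHermiteY q n
  | 1, n => 2 * X 0 * bivariateQHermite q r 0 n
      - C ((1 - q ^ n) * r) * bivariateQHermite q r 0 (n - 1)
  | m + 2, n => 2 * X 0 * bivariateQHermite q r (m + 1) n
      - C (1 - q ^ (m + 1)) * bivariateQHermite q r m n
      - C (q ^ (m + 1) * (1 - q ^ n) * r) * bivariateQHermite q r (m + 1) (n - 1)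

theorem bivariateQHermite_recursion (q r : R) (m n : ℕ) :
    2 * X 0 * bivariateQHermite q r m n =
      bivariateQHermite q r (m + 1) n + C (1 - q ^ m) * bivariateQHermite q r (m - 1) n
        + C (q ^ m * (1 - q ^ n) * r) * bivariateQHermite q r m (n - 1) := by
  rcases m with _ | m
  · simp [bivariateQHermite]
  · simp only [bivariateQHermite, Nat.add_sub_cancel]
    ring

theorem qHermiteY_recursion (q : R) (n : ℕ) :
    2 * X 1 * qHermiteY q n = qHermiteY q (n + 1) + C (1 - q ^ n) * qHermiteY q (n - 1) := by
  rcases n with _ | n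
  · simp [qHermiteY]
  · simp only [qHermiteY, Nat.add_sub_cancel]
    ring

theorem bivariateQHermite_recursion' (q r : R) (m : ℕ) : ∀ n : ℕ,
    2 * X 1 * bivariateQHermite q r m n =
      bivariateQHermite q r m (n + 1) + C (1 - q ^ n) * bivariateQHermite q r m (n - 1)
        + C (q ^ n * (1 - q ^ m) * r) * bivariateQHermite q r (m - 1) n := by
  have e := bivariateQHermite_recursion q r
  have e0 : ∀ n, 2 * X 1 * bivariateQHermite q r 0 n = bivariateQHermite q r 0 (n + 1)
      + C (1 - q ^ n) * bivariateQHermite q r 0 (n - 1) := by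
    intro n
    simpa [bivariateQHermite] using qHermiteY_recursion q n
  generalize bivariateQHermite q r = H at *
  simp only [map_mul, map_sub, map_one, map_pow] at *
  generalize (C q : MvPolynomial (Fin 2) R) = Q at *
  generalize (C r : MvPolynomial (Fin 2) R) = S at *
  generalize (2 * X 0 : MvPolynomial (Fin 2) R) = x at *
  generalize (2 * X 1 : MvPolynomial (Fin 2) R) = y at *
  induction m using Nat.strong_induction_on with
  | _ m ih =>
    intro n
    rcases m with _ | _ | m
    · simp [e0]
    · have a1 := e 0 n
      have a2 := e 0 (n + 1)
      have a3 := e 0 (n - 1)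
      have b1 := e0 n
      have b2 := e0 (n - 1)
      rcases n with _ | _ | n <;>
        simp only [zero_add, pow_zero, sub_self, zero_mul, add_zero, one_mul, pow_one,
          Nat.zero_sub, Nat.sub_self, add_tsub_cancel_right] at *
      · linear_combination (-y) * a1 + a2 + x * b1
      · linear_combination (-y) * a1 + a2 + (1 - Q) * a3 + x * b1 - (1 - Q) * S * b2
      · linear_combination (-y) * a1 + a2 + (1 - Q ^ (n + 1 + 1)) * a3 + x * b1
          - (1 - Q ^ (n + 1 + 1)) * S * b2
    · have a1 := e (m + 1) n
      have a2 := e (m + 1) (n + 1)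
      have a3 := e (m + 1) (n - 1)
      have b1 := ih (m + 1) (by omega) n
      have b2 := ih (m + 1) (by omega) (n - 1)
      have b3 := ih m (by omega) n
      have a4 := e m n
      rcases n with _ | _ | n <;>
        simp only [zero_add, pow_zero, sub_self, zero_mul, add_zero, one_mul, pow_one,
          Nat.zero_sub, Nat.sub_self, add_tsub_cancel_right] at *
      · linear_combination (-y) * a1 + a2 + x * b1 - (1 - Q ^ (m + 1)) * b3
          + (1 - Q ^ (m + 1)) * S * a4
      · linear_combination (-y) * a1 + a2 + (1 - Q) * a3 + x * b1 - (1 - Q ^ (m + 1)) * b3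
          - Q ^ (m + 1) * (1 - Q) * S * b2 + Q * (1 - Q ^ (m + 1)) * S * a4
      · linear_combination (-y) * a1 + a2 + (1 - Q ^ (n + 1 + 1)) * a3 + x * b1
          - (1 - Q ^ (m + 1)) * b3
          - Q ^ (m + 1) * (1 - Q ^ (n + 1 + 1)) * S * b2
          + Q ^ (n + 1 + 1) * (1 - Q ^ (m + 1)) * S * a4

/-- A family satisfying the defining property is unique. -/
theorem IsBivariateQHermite.eq {q r : R} {H H' : ℕ → ℕ → MvPolynomial (Fin 2) R}
    (h : IsBivariateQHermite q r H) (h' : IsBivariateQHermite q r H') : H = H' := by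
  have step : ∀ m, (∀ k ≤ m, ∀ n, (∀ l ≤ n, H k l = H' k l)) → ∀ n, H (m + 1) n = H' (m + 1) n := by
    intro m hm n
    have e := h.recursion m n
    rw [hm m le_rfl n n le_rfl, hm (m - 1) (by omega) n n le_rfl,
      hm m le_rfl (n - 1) _ le_rfl, h'.recursion m n] at e
    exact (add_right_cancel (add_right_cancel e)).symm
  have step0 : ∀ m, H m 0 = H' m 0 := by
    intro m
    induction m using Nat.strong_induction_on with
    | _ m ih =>
      rcases m with _ | m
      · rw [h.zero_zero, h'.zero_zero]
      · have e := h.recursion m 0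
        have e' := h'.recursion m 0
        simp only [pow_zero, sub_self, mul_zero, zero_mul, map_zero, add_zero] at e e'
        rw [ih m (by omega), ih (m - 1) (by omega), e'] at e
        exact (add_right_cancel e).symm
  funext m
  induction m using Nat.strong_induction_on with
  | _ m ih =>
    funext n
    rcases m with _ | m
    · rw [h.symm, h'.symm, step0]
    · exact step m (fun k hk n l _ => congrFun (ih k (by omega)) l) n

/-- The family `bivariateQHermite` satisfies the defining property. -/
theorem isBivariateQHermite (q r : R) : IsBivariateQHermite q r (bivariateQHermite q r) where
  zero_zero := rfl
  recursion := bivariateQHermite_recursion q r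
  symm := by
    have x0 : ∀ n, bivariateQHermite q r n 0 =
        rename (Equiv.swap 0 1) (bivariateQHermite q r 0 n) := by
      intro n
      induction n using Nat.strong_induction_on with
      | _ n ih =>
        rcases n with _ | n
        · simp [bivariateQHermite, qHermiteY]
        · have e := bivariateQHermite_recursion q r n 0
          have e' := congrArg (rename (Equiv.swap (0 : Fin 2) 1))
            (bivariateQHermite_recursion' q r 0 n)
          simp only [pow_zero, sub_self, mul_zero, zero_mul, map_zero, add_zero, map_add, map_mul,
            map_ofNat, rename_X, rename_C, Equiv.swap_apply_right] at e e'
          rw [← ih n (by omega), ← ih (n - 1) (by omega), e] at e'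
          exact add_right_cancel e'
    intro m
    induction m using Nat.strong_induction_on with
    | _ m ih =>
      intro n
      rcases m with _ | m
      · rw [x0 n, rename_rename]
        simp only [Function.comp_def, Equiv.swap_apply_self]
        exact (rename_id_apply _).symm
      · have e := bivariateQHermite_recursion q r m n
        have e' := congrArg (rename (Equiv.swap (0 : Fin 2) 1))
          (bivariateQHermite_recursion' q r n m)
        simp only [map_add, map_mul, map_ofNat, rename_X, rename_C, Equiv.swap_apply_right] at e e'
        rw [← ih m (by omega), ← ih (m - 1) (by omega), ← ih m (by omega), e] at e'
        exact add_right_cancel (add_right_cancel e')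

end QHermite

/-! ### The star product on `H_θ ⋉ T(V⁻)` -/

/-- The data fixed throughout: a symmetrizable generalized Cartan matrix `a` indexed by the finite
set `I`, relatively prime positive symmetrizing integers `d`, an involutive diagram automorphism
`τ` (a symmetry of the symmetrized matrix `(d_i a_{ij})`), a deformation parameter `q` in the field
`K` with `q^{2 d_i} ≠ 1`, and parameters `c_i ∈ K^×`. -/
structure QuasiSplitDatum (I K : Type*) [Fintype I] [Field K] where
  a : Matrix I I ℤ
  a_diag : ∀ i, a i i = 2
  a_nonpos : ∀ i j, i ≠ j → a i j ≤ 0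
  a_zero : ∀ i j, a i j = 0 → a j i = 0
  d : I → ℕ
  d_pos : ∀ i, 0 < d i
  d_gcd : Finset.univ.gcd d = 1
  d_symm : ∀ i j, (d i : ℤ) * a i j = d j * a j i
  τ : Equiv.Perm I
  τ_invol : ∀ i, τ (τ i) = i
  a_τ : ∀ i j, a (τ i) (τ j) = a i j
  d_τ : ∀ i, d (τ i) = d i
  q : Kˣ
  q_ne : ∀ i, q ^ (2 * d i) ≠ 1
  c : I → Kˣ
  c_τ : ∀ i, a i (τ i) = 0 → c i = c (τ i)

namespace QuasiSplitDatum

variable {I K : Type*} [Fintype I] [Field K] (D : QuasiSplitDatum I K)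

/-- The integral power `q^n` as an element of `K`. -/
def qpow (n : ℤ) : K := ((D.q ^ n : Kˣ) : K)

theorem qpow_zero : D.qpow 0 = 1 := by simp [qpow]

theorem qpow_add (m n : ℤ) : D.qpow (m + n) = D.qpow m * D.qpow n := by simp [qpow, zpow_add]

/-- `q_i = q^{d_i}`. -/
def qi (i : I) : Kˣ := D.q ^ D.d i

variable [DecidableEq I]

/-- The simple root `α_i` in the root lattice `Q = ℤ^I`. -/
def simpleRoot (i : I) : I → ℤ := Pi.single i 1

/-- The symmetric bilinear form on `Q` with `(α_i, α_j) = d_i a_{ij}`. -/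
def form : LinearMap.BilinForm ℤ (I → ℤ) :=
  Matrix.toBilin' (Matrix.of fun i j => (D.d i : ℤ) * D.a i j)

theorem form_simpleRoot (i j : I) :
    D.form (simpleRoot i) (simpleRoot j) = D.d i * D.a i j := by
  simp [form, simpleRoot, Matrix.toBilin'_single]

/-- `T(V⁻)` is the free algebra on the generators `F_i = FreeAlgebra.ι K i`. This is its
automorphism `F_j ↦ q^{(β, α_j)} F_j`, which acts on `T(V⁻)_{-μ}` as multiplication by
`q^{(β, μ)}`. -/
def scale (β : I → ℤ) : FreeAlgebra K I →ₐ[K] FreeAlgebra K I :=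
  FreeAlgebra.lift K fun j => D.qpow (D.form β (simpleRoot j)) • FreeAlgebra.ι K j

/-- The weight space `T(V⁻)_{-μ}`, spanned by the words `F_{i_1} ⋯ F_{i_m}` with
`α_{i_1} + ⋯ + α_{i_m} = μ`. -/
def weightSpace (K : Type*) [Field K] (μ : I → ℤ) : Submodule K (FreeAlgebra K I) :=
  Submodule.span K {f | ∃ l : List I, (l.map simpleRoot).sum = μ ∧
    f = (l.map (FreeAlgebra.ι K)).prod}

theorem scale_ι (β : I → ℤ) (j : I) : D.scale β (FreeAlgebra.ι K j) =
    D.qpow (D.form β (simpleRoot j)) • FreeAlgebra.ι K j := by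
  simp [scale]

theorem scale_of_mem (β : I → ℤ) {μ : I → ℤ} {f : FreeAlgebra K I} (hf : f ∈ weightSpace K μ) :
    D.scale β f = D.qpow (D.form β μ) • f := by
  induction hf using Submodule.span_induction with
  | mem f hf =>
    obtain ⟨l, rfl, rfl⟩ := hf
    induction l with
    | nil => simp [qpow_zero]
    | cons i l ih =>
      simp only [List.map_cons, List.prod_cons, List.sum_cons, map_mul, ih, scale_ι, map_add,
        qpow_add, smul_mul_smul_comm]
  | zero => simp
  | add x y _ _ hx hy => simp [hx, hy]
  | smul k x _ hx => rw [map_smul, hx, smul_comm]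

theorem scale_zero : D.scale 0 = AlgHom.id K (FreeAlgebra K I) := by
  ext j
  simp [scale_ι, qpow_zero]

theorem scale_add (β γ : I → ℤ) : D.scale (β + γ) = (D.scale β).comp (D.scale γ) := by
  ext j
  simp only [Function.comp_apply, AlgHom.comp_apply, scale_ι, map_smul, smul_smul, map_add,
    LinearMap.add_apply, qpow_add]
  rw [mul_comm]

/-- The algebra homomorphism `f ↦ [[κ_i(f), ∂_i^L(f)], [0, f]]` that encodes the twisted Leibniz
rule of `∂_i^L`; here `κ_i` multiplies `T(V⁻)_{-μ}` by `q^{(α_i, μ)}`. -/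
def derLMatrix (i : I) : FreeAlgebra K I →ₐ[K] Matrix (Fin 2) (Fin 2) (FreeAlgebra K I) :=
  FreeAlgebra.lift K fun j =>
    !![D.scale (simpleRoot i) (FreeAlgebra.ι K j), if i = j then 1 else 0; 0, FreeAlgebra.ι K j]

/-- The skew derivation `∂_i^L` of `T(V⁻)`; see `derL_ι` and `derL_mul_of_mem` for the properties
that determine it. -/
def derL (i : I) : FreeAlgebra K I →ₗ[K] FreeAlgebra K I :=
  Matrix.entryLinearMap K (FreeAlgebra K I) 0 1 ∘ₗ (D.derLMatrix i).toLinearMap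

theorem derLMatrix_apply (i : I) (f : FreeAlgebra K I) :
    D.derLMatrix i f = !![D.scale (simpleRoot i) f, D.derL i f; 0, f] := by
  have key : D.derLMatrix i f 0 0 = D.scale (simpleRoot i) f ∧ D.derLMatrix i f 1 0 = 0 ∧
      D.derLMatrix i f 1 1 = f := by
    induction f using FreeAlgebra.induction with
    | grade0 r => simp [Matrix.algebraMap_matrix_apply]
    | grade1 j => simp [derLMatrix]
    | mul x y hx hy =>
      simp [Matrix.mul_apply, Fin.sum_univ_two, hx.1, hx.2.1, hx.2.2, hy.1, hy.2.1, hy.2.2]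
    | add x y hx hy => simp [hx.1, hx.2.1, hx.2.2, hy.1, hy.2.1, hy.2.2]
  ext r s
  fin_cases r <;> fin_cases s <;> simp [key, derL]

/-- `∂_i^L(F_j) = δ_{ij}`. -/
theorem derL_ι (i j : I) : D.derL i (FreeAlgebra.ι K j) = if i = j then 1 else 0 := by
  simp [derL, derLMatrix]

theorem derL_one (i : I) : D.derL i 1 = 0 := by
  simp [derL]

theorem derL_mul (i : I) (f g : FreeAlgebra K I) :
    D.derL i (f * g) = D.derL i f * g + D.scale (simpleRoot i) f * D.derL i g := by
  have h := congrFun (congrFun (map_mul (D.derLMatrix i) f g) 0) 1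
  rw [derLMatrix_apply, derLMatrix_apply, derLMatrix_apply] at h
  simpa [Matrix.mul_apply, Fin.sum_univ_two, add_comm] using h

/-- `∂_i^L(fg) = ∂_i^L(f) g + q^{(α_i, μ)} f ∂_i^L(g)` for `f ∈ T(V⁻)_{-μ}`. -/
theorem derL_mul_of_mem (i : I) {μ : I → ℤ} {f : FreeAlgebra K I} (hf : f ∈ weightSpace K μ)
    (g : FreeAlgebra K I) :
    D.derL i (f * g) = D.derL i f * g + D.qpow (D.form (simpleRoot i) μ) • (f * D.derL i g) := by
  rw [derL_mul, D.scale_of_mem _ hf, smul_mul_assoc]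

/-- The subgroup `Q_θ` of `Q` generated by the elements `α_i - α_{τ(i)}`. -/
def Qθ : AddSubgroup (I → ℤ) :=
  AddSubgroup.closure (Set.range fun i => simpleRoot i - simpleRoot (D.τ i))

/-- The group of the elements `K_β`, `β ∈ Q_θ`, i.e. the group generated by the elements
`K_i K_{τ(i)}^{-1}`. -/
def KGroup : Type _ := Multiplicative D.Qθ

instance : CommGroup D.KGroup := inferInstanceAs (CommGroup (Multiplicative D.Qθ))

/-- The group element `K_β` for `β ∈ Q_θ`. -/
def KGroup.mk (β : D.Qθ) : D.KGroup := Multiplicative.ofAdd β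

/-- The weight `β` of the group element `K_β`. -/
def KGroup.weight {D : QuasiSplitDatum I K} (g : D.KGroup) : I → ℤ :=
  (Multiplicative.toAdd (show Multiplicative D.Qθ from g) : D.Qθ).1

/-- The group element `K_i K_{τ(i)}^{-1}`. -/
def kTwist (i : I) : D.KGroup :=
  KGroup.mk D ⟨simpleRoot i - simpleRoot (D.τ i), AddSubgroup.subset_closure ⟨i, rfl⟩⟩

theorem weight_one : KGroup.weight (1 : D.KGroup) = 0 := rfl

theorem weight_mul (g h : D.KGroup) : (g * h).weight = g.weight + h.weight := rfl

/-- The action of the group on `T(V⁻)` with `K_β F_i K_β^{-1} = q^{-(β, α_i)} F_i`. -/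
instance : MulSemiringAction D.KGroup (FreeAlgebra K I) where
  smul g f := D.scale (-g.weight) f
  one_smul f := by
    change D.scale (-KGroup.weight (1 : D.KGroup)) f = f
    rw [weight_one, neg_zero, scale_zero]
    rfl
  mul_smul g h f := by
    change D.scale (-(g * h).weight) f = D.scale (-g.weight) (D.scale (-h.weight) f)
    rw [weight_mul, neg_add, scale_add]
    rfl
  smul_zero g := map_zero (D.scale (-g.weight))
  smul_add g := map_add (D.scale (-g.weight))
  smul_one g := map_one (D.scale (-g.weight))
  smul_mul g := map_mul (D.scale (-g.weight))

theorem KGroup.smul_def {D : QuasiSplitDatum I K} (g : D.KGroup) (f : FreeAlgebra K I) :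
    g • f = D.scale (-g.weight) f := rfl

instance : SMulCommClass D.KGroup K (FreeAlgebra K I) where
  smul_comm g k f := map_smul (D.scale (-g.weight)) k f

/-- The algebra `H_θ ⋉ T(V⁻)`: its elements are the finite sums `∑ f_β K_β` with `f_β ∈ T(V⁻)` and
`β ∈ Q_θ`, multiplied according to `K_β F_i = q^{-(β, α_i)} F_i K_β`. -/
abbrev HT : Type _ := SkewMonoidAlgebra (FreeAlgebra K I) D.KGroup

instance : SMulCommClass K D.HT D.HT := Algebra.to_smulCommClass

instance : IsScalarTower K D.HT D.HT := IsScalarTower.right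

/-- The embedding of `T(V⁻)` into `H_θ ⋉ T(V⁻)`. -/
def ofT : FreeAlgebra K I →ₐ[K] D.HT :=
  { SkewMonoidAlgebra.singleOneRingHom with
    commutes' := fun r => by
      rw [SkewMonoidAlgebra.coe_algebraMap]
      rfl }

/-- The group element `K_β` as an element of `H_θ ⋉ T(V⁻)`. -/
def ofK (g : D.KGroup) : D.HT := SkewMonoidAlgebra.single g 1

/-- The generator `F_i` of `H_θ ⋉ T(V⁻)`. -/
def F (i : I) : D.HT := D.ofT (FreeAlgebra.ι K i)

/-- The subalgebra `H_θ` of `H_θ ⋉ T(V⁻)`, generated by the elements `(K_i K_{τ(i)}^{-1})^{±1}`. -/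
def Hθ : Subalgebra K D.HT :=
  Algebra.adjoin K (Set.range (fun i => D.ofK (D.kTwist i)) ∪
    Set.range (fun i => D.ofK (D.kTwist i)⁻¹))

/-- The coefficient `c_i q^{(α_i, α_{τ(i)})} / (q_i - q_i^{-1})`. -/
def starCoeff (i : I) : K :=
  D.c i * D.qpow (D.form (simpleRoot i) (simpleRoot (D.τ i))) / (D.qi i - (D.qi i : K)⁻¹)

/-- The bilinear map `star` is the star product `⊛` on `H_θ ⋉ T(V⁻)`: it is associative, satisfies
`h ⊛ u = h u` and `u ⊛ h = u h` for `h ∈ H_θ`, and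
`F_i ⊛ g = F_i g - (c_i q^{(α_i, α_{τ(i)})} / (q_i - q_i^{-1})) K_{τ(i)} K_i^{-1} ∂_{τ(i)}^L(g)`
for `g ∈ T(V⁻)`. -/
structure IsStarProduct (star : D.HT →ₗ[K] D.HT →ₗ[K] D.HT) : Prop where
  assoc : ∀ u v w, star (star u v) w = star u (star v w)
  H_left : ∀ h ∈ D.Hθ, ∀ u, star h u = h * u
  H_right : ∀ h ∈ D.Hθ, ∀ u, star u h = u * h
  F_left : ∀ i g, star (D.F i) (D.ofT g) = D.F i * D.ofT g -
    D.starCoeff i • (D.ofK (D.kTwist i)⁻¹ * D.ofT (D.derL (D.τ i) g))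

set_option linter.unusedSectionVars false

/-! #### Existence and uniqueness of the star product -/

theorem form_weight_simpleRoot (g : D.KGroup) (i : I) :
    D.form g.weight (simpleRoot i + simpleRoot (D.τ i)) = 0 := by
  have key : ∀ β ∈ D.Qθ, D.form β (simpleRoot i + simpleRoot (D.τ i)) = 0 := by
    intro β hβ
    induction hβ using AddSubgroup.closure_induction with
    | mem β hβ =>
      obtain ⟨j, rfl⟩ := hβ
      have h1 := D.a_τ j i
      have h2 := D.a_τ j (D.τ i)
      rw [D.τ_invol] at h2
      simp only [map_add, map_sub, LinearMap.sub_apply, form_simpleRoot, h1, h2, D.d_τ]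
      ring
    | zero => simp
    | add x y _ _ hx hy => rw [map_add D.form, LinearMap.add_apply, hx, hy, add_zero]
    | neg x _ hx => rw [map_neg D.form, LinearMap.neg_apply, hx, neg_zero]
  exact key _ (Multiplicative.toAdd (show Multiplicative D.Qθ from g) : D.Qθ).2

theorem smul_ι (g : D.KGroup) (i : I) : g • FreeAlgebra.ι K i =
    D.qpow (-D.form g.weight (simpleRoot i)) • FreeAlgebra.ι K i := by
  rw [KGroup.smul_def, scale_ι, map_neg, LinearMap.neg_apply]

theorem derL_scale (β : I → ℤ) (i : I) (f : FreeAlgebra K I) :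
    D.derL i (D.scale β f) =
      D.qpow (D.form β (simpleRoot i)) • D.scale β (D.derL i f) := by
  induction f using FreeAlgebra.induction with
  | grade0 r => simp [Algebra.algebraMap_eq_smul_one, derL_one]
  | grade1 j =>
    rw [scale_ι, map_smul, derL_ι]
    split_ifs with h
    · rw [h, map_one]
    · simp
  | mul x y hx hy =>
    have comm : ∀ γ z, D.scale γ (D.scale β z) = D.scale β (D.scale γ z) := by
      intro γ z
      have h := D.scale_add γ β
      rw [add_comm, scale_add] at h
      exact (DFunLike.congr_fun h z).symm
    simp only [map_mul, derL_mul, hx, hy, map_add, smul_add, comm, smul_mul_assoc, mul_smul_comm]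
  | add x y hx hy => simp [hx, hy]

theorem ofK_mul (g : D.KGroup) (h : D.KGroup) (f : FreeAlgebra K I) :
    D.ofK g * SkewMonoidAlgebra.single h f = SkewMonoidAlgebra.single (g * h) (g • f) := by
  rw [ofK, SkewMonoidAlgebra.single_mul_single, one_mul]

theorem mul_ofK (g : D.KGroup) (h : D.KGroup) (f : FreeAlgebra K I) :
    SkewMonoidAlgebra.single h f * D.ofK g = SkewMonoidAlgebra.single (h * g) f := by
  rw [ofK, SkewMonoidAlgebra.single_mul_single, smul_one, mul_one]

theorem ofT_mul (f f' : FreeAlgebra K I) (h : D.KGroup) :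
    D.ofT f * SkewMonoidAlgebra.single h f' = SkewMonoidAlgebra.single h (f * f') := by
  change SkewMonoidAlgebra.single 1 f * SkewMonoidAlgebra.single h f' = _
  rw [SkewMonoidAlgebra.single_mul_single, one_mul, one_smul]

theorem single_eq (f : FreeAlgebra K I) (h : D.KGroup) :
    (SkewMonoidAlgebra.single h f : D.HT) = D.ofT f * D.ofK h := by
  rw [ofK, ofT_mul, mul_one]

theorem ofK_mul_ofK (g h : D.KGroup) : D.ofK g * D.ofK h = D.ofK (g * h) := by
  change D.ofK g * SkewMonoidAlgebra.single h 1 = _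
  rw [ofK_mul, smul_one]
  rfl

theorem ofK_one : D.ofK 1 = 1 := rfl

theorem ofK_mem_Hθ (g : D.KGroup) : D.ofK g ∈ D.Hθ := by
  have key : ∀ (x : I → ℤ) (hx : x ∈ D.Qθ), D.ofK (KGroup.mk D ⟨x, hx⟩) ∈ D.Hθ ∧
      D.ofK (KGroup.mk D ⟨-x, D.Qθ.neg_mem hx⟩) ∈ D.Hθ := by
    intro x hx
    induction hx using AddSubgroup.closure_induction with
    | mem x hx =>
      obtain ⟨j, rfl⟩ := hx
      exact ⟨Algebra.subset_adjoin (Or.inl ⟨j, rfl⟩), Algebra.subset_adjoin (Or.inr ⟨j, rfl⟩)⟩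
    | zero =>
      refine ⟨D.Hθ.one_mem, ?_⟩
      simp only [neg_zero]
      exact D.Hθ.one_mem
    | add x y hx hy h1 h2 =>
      have h3 := D.Hθ.mul_mem h1.1 h2.1
      have h4 := D.Hθ.mul_mem h1.2 h2.2
      rw [D.ofK_mul_ofK] at h3 h4
      refine ⟨h3, ?_⟩
      simp only [neg_add]
      exact h4
    | neg x hx h =>
      refine ⟨h.2, ?_⟩
      simp only [neg_neg]
      exact h.1
  exact (key _ (Multiplicative.toAdd (show Multiplicative D.Qθ from g) : D.Qθ).2).1

/-- Apply a linear map of `T(V⁻)` to all coefficients `f_β` of `∑ f_β K_β`. -/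
def mapCoef (φ : FreeAlgebra K I →ₗ[K] FreeAlgebra K I) : D.HT →ₗ[K] D.HT :=
  (SkewMonoidAlgebra.coeffLinearEquiv (S := K)).symm.toLinearMap ∘ₗ
    Finsupp.mapRange.linearMap φ ∘ₗ (SkewMonoidAlgebra.coeffLinearEquiv (S := K)).toLinearMap

theorem mapCoef_single (φ : FreeAlgebra K I →ₗ[K] FreeAlgebra K I) (g : D.KGroup)
    (f : FreeAlgebra K I) :
    D.mapCoef φ (SkewMonoidAlgebra.single g f) = SkewMonoidAlgebra.single g (φ f) := by
  apply SkewMonoidAlgebra.coeff_injective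
  exact Finsupp.mapRange_single (hf := map_zero φ)

/-- The operator of left star multiplication by `F_i`. -/
def starF (i : I) : D.HT →ₗ[K] D.HT :=
  LinearMap.mulLeft K (D.F i) - D.starCoeff i •
    (LinearMap.mulLeft K (D.ofK (D.kTwist i)⁻¹) ∘ₗ D.mapCoef (D.derL (D.τ i)))

theorem starF_apply (i : I) (u : D.HT) : D.starF i u = D.F i * u -
    D.starCoeff i • (D.ofK (D.kTwist i)⁻¹ * D.mapCoef (D.derL (D.τ i)) u) := rfl

theorem starF_single (i : I) (g : D.KGroup) (f : FreeAlgebra K I) :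
    D.starF i (SkewMonoidAlgebra.single g f) =
      SkewMonoidAlgebra.single g (FreeAlgebra.ι K i * f) - D.starCoeff i •
        SkewMonoidAlgebra.single ((D.kTwist i)⁻¹ * g) ((D.kTwist i)⁻¹ • D.derL (D.τ i) f) := by
  rw [starF_apply, mapCoef_single, F, ofT_mul, ofK_mul]

theorem starF_mul_ofK (i : I) (u : D.HT) (g : D.KGroup) :
    D.starF i (u * D.ofK g) = D.starF i u * D.ofK g := by
  induction u using SkewMonoidAlgebra.induction_on with
  | zero => simp
  | single h f =>
    rw [mul_ofK, starF_single, starF_single, sub_mul, smul_mul_assoc, mul_ofK, mul_ofK, mul_assoc]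
  | add x y hx hy => simp only [add_mul, map_add, hx, hy]

theorem ofK_mul_starF (i : I) (u : D.HT) (g : D.KGroup) :
    D.ofK g * D.starF i u =
      D.qpow (-D.form g.weight (simpleRoot i)) • D.starF i (D.ofK g * u) := by
  induction u using SkewMonoidAlgebra.induction_on with
  | zero => simp
  | single h f =>
    have e : D.qpow (-D.form g.weight (simpleRoot i)) *
        D.qpow (-D.form g.weight (simpleRoot (D.τ i))) = 1 := by
      rw [← qpow_add, ← neg_add, ← map_add, form_weight_simpleRoot, neg_zero, qpow_zero]
    have e2 : D.derL (D.τ i) (g • f) =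
        D.qpow (-D.form g.weight (simpleRoot (D.τ i))) • g • D.derL (D.τ i) f := by
      rw [KGroup.smul_def, derL_scale, map_neg, LinearMap.neg_apply, KGroup.smul_def]
    have e3 : (SkewMonoidAlgebra.single ((D.kTwist i)⁻¹ * (g * h))
        ((D.kTwist i)⁻¹ • D.derL (D.τ i) (g • f)) : D.HT) =
        D.qpow (-D.form g.weight (simpleRoot (D.τ i))) •
          SkewMonoidAlgebra.single (g * ((D.kTwist i)⁻¹ * h))
            (g • (D.kTwist i)⁻¹ • D.derL (D.τ i) f) := by
      rw [e2, smul_comm (D.kTwist i)⁻¹ (D.qpow _), ← SkewMonoidAlgebra.smul_single (D.qpow _),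
        smul_smul (D.kTwist i)⁻¹, smul_smul g, mul_comm g (D.kTwist i)⁻¹, mul_left_comm g]
    rw [ofK_mul, starF_single, starF_single, mul_sub, mul_smul_comm, ofK_mul, ofK_mul, e3,
      smul_comm (D.starCoeff i) (D.qpow _), smul_sub, smul_smul (D.qpow _) (D.qpow _), e, one_smul, smul_mul', smul_ι,
      smul_mul_assoc, ← SkewMonoidAlgebra.smul_single (D.qpow _)]
  | add x y hx hy => simp only [mul_add, map_add, hx, hy, smul_add]

/-- The action of `T(V⁻)` on `H_θ ⋉ T(V⁻)` in which `F_i` acts by left star multiplication. -/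
def starT : FreeAlgebra K I →ₐ[K] Module.End K D.HT := FreeAlgebra.lift K D.starF

theorem starT_ι (i : I) : D.starT (FreeAlgebra.ι K i) = D.starF i := by simp [starT]

theorem starT_mul_ofK (f : FreeAlgebra K I) (g : D.KGroup) : ∀ u : D.HT,
    D.starT f (u * D.ofK g) = D.starT f u * D.ofK g := by
  induction f using FreeAlgebra.induction with
  | grade0 r => intro u; simp [Algebra.algebraMap_eq_smul_one, smul_mul_assoc]
  | grade1 i => intro u; rw [starT_ι, starF_mul_ofK]
  | mul x y hx hy => intro u; simp [Module.End.mul_apply, hx, hy]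
  | add x y hx hy => intro u; simp [hx, hy, add_mul]

theorem starT_smul (f : FreeAlgebra K I) (g : D.KGroup) : ∀ u : D.HT,
    D.starT (g • f) (D.ofK g * u) = D.ofK g * D.starT f u := by
  induction f using FreeAlgebra.induction with
  | grade0 r =>
    intro u
    rw [KGroup.smul_def, AlgHom.commutes]
    simp [Algebra.algebraMap_eq_smul_one, mul_smul_comm]
  | grade1 i =>
    intro u
    rw [smul_ι, map_smul, starT_ι, LinearMap.smul_apply, ofK_mul_starF]
  | mul x y hx hy => intro u; simp [smul_mul', Module.End.mul_apply, hx, hy]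
  | add x y hx hy => intro u; simp [hx, hy, mul_add]

/-- The linear map that sends an ordinary monomial to the corresponding star monomial. -/
def toStar : D.HT →ₗ[K] D.HT :=
  (Finsupp.lsum K fun g => LinearMap.applyₗ (D.ofK g) ∘ₗ D.starT.toLinearMap) ∘ₗ
    (SkewMonoidAlgebra.coeffLinearEquiv (S := K)).toLinearMap

theorem toStar_single (g : D.KGroup) (f : FreeAlgebra K I) :
    D.toStar (SkewMonoidAlgebra.single g f) = D.starT f (D.ofK g) := by
  change Finsupp.lsum K _ (Finsupp.single g f) = _
  rw [Finsupp.lsum_single]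
  rfl

theorem toStar_ofK (g : D.KGroup) : D.toStar (D.ofK g) = D.ofK g := by
  conv_lhs => rw [ofK, toStar_single, map_one]
  rfl

theorem toStar_ofK_mul (g : D.KGroup) (u : D.HT) :
    D.toStar (D.ofK g * u) = D.ofK g * D.toStar u := by
  induction u using SkewMonoidAlgebra.induction_on with
  | zero => simp
  | single h f =>
    rw [ofK_mul, toStar_single, toStar_single, ← ofK_mul_ofK, starT_smul]
  | add x y hx hy => simp only [mul_add, map_add, hx, hy]

theorem toStar_mul_ofK (g : D.KGroup) (u : D.HT) :
    D.toStar (u * D.ofK g) = D.toStar u * D.ofK g := by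
  induction u using SkewMonoidAlgebra.induction_on with
  | zero => simp
  | single h f =>
    rw [mul_ofK, toStar_single, toStar_single, ← ofK_mul_ofK, starT_mul_ofK]
  | add x y hx hy => simp only [add_mul, map_add, hx, hy]

theorem toStar_F_mul (i : I) (u : D.HT) : D.toStar (D.F i * u) = D.starF i (D.toStar u) := by
  induction u using SkewMonoidAlgebra.induction_on with
  | zero => simp
  | single h f =>
    rw [F, ofT_mul, toStar_single, toStar_single, map_mul, starT_ι, Module.End.mul_apply]
  | add x y hx hy => simp only [mul_add, map_add, hx, hy]

/-- The filtration of `T(V⁻)` by word length `< n`. -/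
def filT (K : Type*) [Field K] (n : ℕ) : Submodule K (FreeAlgebra K I) :=
  Submodule.span K {f | ∃ l : List I, l.length < n ∧ f = (l.map (FreeAlgebra.ι K)).prod}

/-- The filtration of `H_θ ⋉ T(V⁻)` by word length `< n`. -/
def fil (n : ℕ) : Submodule K D.HT :=
  Submodule.span K {u | ∃ (g : D.KGroup) (l : List I), l.length < n ∧
    u = SkewMonoidAlgebra.single g (l.map (FreeAlgebra.ι K)).prod}

theorem fil_mono {m n : ℕ} (h : m ≤ n) : D.fil m ≤ D.fil n :=
  Submodule.span_mono fun _ ⟨g, l, hl, e⟩ => ⟨g, l, hl.trans_le h, e⟩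

theorem single_mem_fil {n : ℕ} {f : FreeAlgebra K I} (hf : f ∈ filT K n) (g : D.KGroup) :
    (SkewMonoidAlgebra.single g f : D.HT) ∈ D.fil n := by
  induction hf using Submodule.span_induction with
  | mem f hf =>
    obtain ⟨l, hl, rfl⟩ := hf
    exact Submodule.subset_span ⟨g, l, hl, rfl⟩
  | zero => rw [SkewMonoidAlgebra.single_zero]; exact zero_mem _
  | add x y _ _ hx hy => rw [SkewMonoidAlgebra.single_add]; exact add_mem hx hy
  | smul k x _ hx => rw [← SkewMonoidAlgebra.smul_single]; exact Submodule.smul_mem _ _ hx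

theorem filT_mono {m n : ℕ} (h : m ≤ n) : filT (I := I) K m ≤ filT K n :=
  Submodule.span_mono fun _ ⟨l, hl, e⟩ => ⟨l, hl.trans_le h, e⟩

theorem ι_mul_mem_filT {n : ℕ} (i : I) {f : FreeAlgebra K I} (hf : f ∈ filT K n) :
    FreeAlgebra.ι K i * f ∈ filT K (n + 1) := by
  induction hf using Submodule.span_induction with
  | mem f hf =>
    obtain ⟨l, hl, rfl⟩ := hf
    exact Submodule.subset_span ⟨i :: l, by simpa using hl, by simp⟩
  | zero => simp
  | add x y _ _ hx hy => rw [mul_add]; exact add_mem hx hy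
  | smul k x _ hx => rw [mul_smul_comm]; exact Submodule.smul_mem _ _ hx

theorem derL_word_mem (i : I) (l : List I) :
    D.derL i (l.map (FreeAlgebra.ι K)).prod ∈ filT K l.length := by
  induction l with
  | nil => simp [derL_one]
  | cons j l ih =>
    rw [List.map_cons, List.prod_cons, derL_mul, derL_ι, scale_ι, smul_mul_assoc]
    refine add_mem ?_ (Submodule.smul_mem _ _ (ι_mul_mem_filT j ih))
    split_ifs
    · rw [one_mul]
      exact Submodule.subset_span ⟨l, by simp, rfl⟩
    · rw [zero_mul]
      exact zero_mem _

theorem smul_word_mem (g : D.KGroup) {n : ℕ} {f : FreeAlgebra K I} (hf : f ∈ filT K n) :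
    g • f ∈ filT K n := by
  induction hf using Submodule.span_induction with
  | mem f hf =>
    obtain ⟨l, hl, rfl⟩ := hf
    rw [KGroup.smul_def, D.scale_of_mem (μ := (l.map simpleRoot).sum) _
      (Submodule.subset_span ⟨l, rfl, rfl⟩)]
    exact Submodule.smul_mem _ _ (Submodule.subset_span ⟨l, hl, rfl⟩)
  | zero => rw [smul_zero]; exact zero_mem _
  | add x y _ _ hx hy => rw [smul_add]; exact add_mem hx hy
  | smul k x _ hx => rw [smul_comm]; exact Submodule.smul_mem _ _ hx

theorem starF_sub_mem (i : I) (g : D.KGroup) (l : List I) :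
    D.starCoeff i • (SkewMonoidAlgebra.single ((D.kTwist i)⁻¹ * g)
      ((D.kTwist i)⁻¹ • D.derL (D.τ i) (l.map (FreeAlgebra.ι K)).prod) : D.HT) ∈
      D.fil l.length :=
  Submodule.smul_mem _ _ (D.single_mem_fil (D.smul_word_mem _ (D.derL_word_mem _ l)) _)

theorem starF_mem (i : I) {n : ℕ} {u : D.HT} (hu : u ∈ D.fil n) : D.starF i u ∈ D.fil (n + 1) := by
  induction hu using Submodule.span_induction with
  | mem u hu =>
    obtain ⟨g, l, hl, rfl⟩ := hu
    rw [starF_single]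
    refine sub_mem (Submodule.subset_span ⟨g, i :: l, by simpa using hl, by simp⟩)
      (D.fil_mono (by omega) (D.starF_sub_mem i g l))
  | zero => simp
  | add x y _ _ hx hy => rw [map_add]; exact add_mem hx hy
  | smul k x _ hx => rw [map_smul]; exact Submodule.smul_mem _ _ hx

theorem toStar_sub_mem (g : D.KGroup) (l : List I) :
    SkewMonoidAlgebra.single g (l.map (FreeAlgebra.ι K)).prod -
      D.toStar (SkewMonoidAlgebra.single g (l.map (FreeAlgebra.ι K)).prod) ∈ D.fil l.length := by
  induction l with
  | nil =>
    have e := D.toStar_ofK g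
    rw [ofK] at e
    rw [List.map_nil, List.prod_nil, e, sub_self]
    exact zero_mem _
  | cons j l ih =>
    rw [List.map_cons, List.prod_cons, ← ofT_mul]
    change D.F j * _ - D.toStar (D.F j * _) ∈ _
    rw [toStar_F_mul]
    have h := D.starF_mem j ih
    rw [map_sub, starF_single, ← ofT_mul] at h
    have h2 := add_mem h (D.fil_mono (Nat.le_succ _) (D.starF_sub_mem j g l))
    rw [sub_sub, add_comm (_ • _), ← sub_sub, sub_add_cancel] at h2
    exact h2

theorem exists_mem_fil (u : D.HT) : ∃ n, u ∈ D.fil n := by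
  have hT : ∀ f : FreeAlgebra K I, ∃ n, f ∈ filT K n := by
    intro f
    have hf : f ∈ Submodule.span K
        (Set.range fun l : FreeMonoid I => (l.toList.map (FreeAlgebra.ι K)).prod) := by
      refine (Submodule.eq_top_iff'.1 ?_) f
      rw [← (FreeAlgebra.basisFreeMonoid K I).span_eq]
      congr 1
      apply congrArg Set.range
      funext l
      change _ = (FreeAlgebra.equivMonoidAlgebraFreeMonoid (R := K) (X := I)).symm
        (MonoidAlgebra.single l 1)
      simp [FreeAlgebra.equivMonoidAlgebraFreeMonoid, FreeMonoid.lift_apply]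
    induction hf using Submodule.span_induction with
    | mem f hf =>
      obtain ⟨l, rfl⟩ := hf
      exact ⟨_, Submodule.subset_span ⟨l.toList, Nat.lt_succ_self _, rfl⟩⟩
    | zero => exact ⟨0, zero_mem _⟩
    | add x y _ _ hx hy =>
      obtain ⟨m, hm⟩ := hx
      obtain ⟨n, hn⟩ := hy
      exact ⟨max m n, add_mem (filT_mono (le_max_left _ _) hm) (filT_mono (le_max_right _ _) hn)⟩
    | smul k x _ hx =>
      obtain ⟨m, hm⟩ := hx
      exact ⟨m, Submodule.smul_mem _ _ hm⟩
  induction u using SkewMonoidAlgebra.induction_on with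
  | zero => exact ⟨0, zero_mem _⟩
  | single g f =>
    obtain ⟨n, hn⟩ := hT f
    exact ⟨n, D.single_mem_fil hn g⟩
  | add x y hx hy =>
    obtain ⟨m, hm⟩ := hx
    obtain ⟨n, hn⟩ := hy
    exact ⟨max m n, add_mem (D.fil_mono (le_max_left _ _) hm) (D.fil_mono (le_max_right _ _) hn)⟩

theorem sub_toStar_mem {n : ℕ} {u : D.HT} (hu : u ∈ D.fil (n + 1)) : u - D.toStar u ∈ D.fil n := by
  induction hu using Submodule.span_induction with
  | mem u hu =>
    obtain ⟨g, l, hl, rfl⟩ := hu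
    exact D.fil_mono (Nat.lt_succ_iff.1 hl) (D.toStar_sub_mem g l)
  | zero => simp
  | add x y _ _ hx hy =>
    rw [map_add, add_sub_add_comm]
    exact add_mem hx hy
  | smul k x _ hx =>
    rw [map_smul, ← smul_sub]
    exact Submodule.smul_mem _ _ hx

theorem fil_zero {u : D.HT} (hu : u ∈ D.fil 0) : u = 0 := by
  have e : D.fil 0 = ⊥ := by
    rw [fil, Submodule.span_eq_bot]
    rintro _ ⟨g, l, hl, _⟩
    exact absurd hl (Nat.not_lt_zero _)
  rwa [e, Submodule.mem_bot] at hu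

theorem toStar_bijective : Function.Bijective D.toStar := by
  constructor
  · rw [injective_iff_map_eq_zero]
    intro u hu
    obtain ⟨n, hn⟩ := D.exists_mem_fil u
    induction n with
    | zero => exact D.fil_zero hn
    | succ n ih =>
      have h := D.sub_toStar_mem hn
      rw [hu, sub_zero] at h
      exact ih h
  · intro u
    obtain ⟨n, hn⟩ := D.exists_mem_fil u
    induction n generalizing u with
    | zero => exact ⟨0, by rw [D.fil_zero hn, map_zero]⟩
    | succ n ih =>
      obtain ⟨v, hv⟩ := ih _ (D.sub_toStar_mem hn)
      exact ⟨v + u, by rw [map_add, hv, sub_add_cancel]⟩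

/-- `toStar` as a linear equivalence. -/
def toStarEquiv : D.HT ≃ₗ[K] D.HT := LinearEquiv.ofBijective D.toStar D.toStar_bijective

theorem isStarProduct_transport : D.IsStarProduct
    (((LinearMap.mul K D.HT).compl₁₂ D.toStarEquiv.symm.toLinearMap
      D.toStarEquiv.symm.toLinearMap).compr₂ D.toStar) := by
  have e1 : ∀ u, D.toStarEquiv.symm (D.toStar u) = u := D.toStarEquiv.symm_apply_apply
  have e2 : ∀ u, D.toStar (D.toStarEquiv.symm u) = u := D.toStarEquiv.apply_symm_apply
  have kk : ∀ g, D.toStarEquiv.symm (D.ofK g) = D.ofK g := by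
    intro g
    conv_lhs => rw [← toStar_ofK, e1]
  have ff : ∀ i, D.toStarEquiv.symm (D.F i) = D.F i := by
    intro i
    have h := D.toStar_F_mul i (D.ofK 1)
    rw [toStar_ofK, ofK_one, mul_one] at h
    have h2 : D.starF i 1 = D.F i := by
      change D.starF i (SkewMonoidAlgebra.single 1 1) = _
      rw [starF_single, derL_one, smul_zero, SkewMonoidAlgebra.single_zero, smul_zero, sub_zero,
        mul_one]
      rfl
    conv_lhs => rw [← h2, ← h, e1]
  have hh : ∀ h ∈ D.Hθ, D.toStarEquiv.symm h = h ∧ (∀ u, D.toStar (h * u) = h * D.toStar u) ∧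
      ∀ u, D.toStar (u * h) = D.toStar u * h := by
    intro h hh
    have hK : ∀ g, D.toStarEquiv.symm (D.ofK g) = D.ofK g ∧
        (∀ u, D.toStar (D.ofK g * u) = D.ofK g * D.toStar u) ∧
        ∀ u, D.toStar (u * D.ofK g) = D.toStar u * D.ofK g :=
      fun g => ⟨kk g, D.toStar_ofK_mul g, D.toStar_mul_ofK g⟩
    induction hh using Algebra.adjoin_induction with
    | mem x hx =>
      rcases hx with ⟨i, rfl⟩ | ⟨i, rfl⟩
      · exact hK _
      · exact hK _
    | algebraMap r =>
      rw [Algebra.algebraMap_eq_smul_one, ← ofK_one]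
      refine ⟨by rw [map_smul, kk], fun u => ?_, fun u => ?_⟩
      · rw [smul_mul_assoc, map_smul, toStar_ofK_mul, smul_mul_assoc]
      · rw [mul_smul_comm, map_smul, toStar_mul_ofK, mul_smul_comm]
    | add x y _ _ hx hy =>
      refine ⟨by rw [map_add, hx.1, hy.1], fun u => ?_, fun u => ?_⟩
      · rw [add_mul, map_add, hx.2.1, hy.2.1, add_mul]
      · rw [mul_add, map_add, hx.2.2, hy.2.2, mul_add]
    | mul x y _ _ hx hy =>
      refine ⟨?_, fun u => ?_, fun u => ?_⟩
      · rw [LinearEquiv.symm_apply_eq]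
        change _ = D.toStar (x * y)
        rw [hx.2.1]
        conv_rhs => rw [← hy.1, e2]
      · rw [mul_assoc, hx.2.1, hy.2.1, mul_assoc]
      · rw [← mul_assoc, hy.2.2, hx.2.2, mul_assoc]
  constructor
  · intro u v w
    simp [e1, mul_assoc]
  · intro h hm u
    simp only [LinearMap.compr₂_apply, LinearMap.compl₁₂_apply, LinearEquiv.coe_coe,
      LinearMap.mul_apply', (hh h hm).1, (hh h hm).2.1, e2]
  · intro h hm u
    simp only [LinearMap.compr₂_apply, LinearMap.compl₁₂_apply, LinearEquiv.coe_coe,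
      LinearMap.mul_apply', (hh h hm).1, (hh h hm).2.2, e2]
  · intro i g
    simp only [LinearMap.compr₂_apply, LinearMap.compl₁₂_apply, LinearEquiv.coe_coe, ff,
      LinearMap.mul_apply', toStar_F_mul, e2]
    change D.starF i (SkewMonoidAlgebra.single 1 g) = _
    rw [starF_apply, mapCoef_single]
    rfl

theorem IsStarProduct.eq {D : QuasiSplitDatum I K} {s s' : D.HT →ₗ[K] D.HT →ₗ[K] D.HT}
    (h : D.IsStarProduct s) (h' : D.IsStarProduct s') : s = s' := by
  have key : ∀ {t : D.HT →ₗ[K] D.HT →ₗ[K] D.HT}, D.IsStarProduct t → ∀ g f u,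
      t (D.toStar (SkewMonoidAlgebra.single g f)) u = D.starT f (D.ofK g * u) := by
    intro t ht g f u
    have hF : ∀ i u, t (D.F i) u = D.starF i u := by
      intro i u
      induction u using SkewMonoidAlgebra.induction_on with
      | zero => simp
      | single g f =>
        rw [single_eq, starF_mul_ofK, ← ht.H_right _ (D.ofK_mem_Hθ g), ← ht.assoc, ht.F_left,
          ht.H_right _ (D.ofK_mem_Hθ g)]
        congr 1
        change _ = D.starF i (SkewMonoidAlgebra.single 1 f)
        rw [starF_apply, mapCoef_single]
        rfl
      | add x y hx hy => rw [map_add, map_add, hx, hy]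
    have hT : ∀ u v, t (D.starT f u) v = D.starT f (t u v) := by
      induction f using FreeAlgebra.induction with
      | grade0 r => intro u v; simp [Algebra.algebraMap_eq_smul_one]
      | grade1 i => intro u v; rw [starT_ι, ← hF, ht.assoc, hF]
      | mul x y hx hy => intro u v; simp [Module.End.mul_apply, hx, hy]
      | add x y hx hy => intro u v; simp [hx, hy]
    rw [toStar_single, hT, ht.H_left _ (D.ofK_mem_Hθ g)]
  refine LinearMap.ext fun u => LinearMap.ext fun v => ?_
  obtain ⟨w, rfl⟩ := D.toStar_bijective.2 u
  induction w using SkewMonoidAlgebra.induction_on with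
  | zero => simp
  | single g f => rw [key h, key h']
  | add x y hx hy => simp only [map_add, LinearMap.add_apply, hx, hy]

theorem existsUnique_star : ∃! star : D.HT →ₗ[K] D.HT →ₗ[K] D.HT, D.IsStarProduct star :=
  ⟨_, D.isStarProduct_transport, fun _ h => h.eq D.isStarProduct_transport⟩

/-- The star product `⊛` on `H_θ ⋉ T(V⁻)`. -/
def star : D.HT →ₗ[K] D.HT →ₗ[K] D.HT := D.existsUnique_star.choose

theorem isStarProduct_star : D.IsStarProduct D.star := D.existsUnique_star.choose_spec.1

/-- The star power `u^{⊛ n} = u ⊛ ⋯ ⊛ u`. -/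
def starPow (u : D.HT) : ℕ → D.HT
  | 0 => 1
  | n + 1 => D.star u (starPow u n)

/-- For `w = ∑ b_{rs} x^r y^s` this is the element
`u₃ ↷ w(u₁ ⊛, u₂) = ∑ b_{rs} u₁^{⊛ r} ⊛ u₃ ⊛ u₂^{⊛ s}`. -/
def starAct (u₃ : D.HT) (w : MvPolynomial (Fin 2) K) (u₁ u₂ : D.HT) : D.HT :=
  ∑ e ∈ w.support, w.coeff e •
    D.star (D.star (D.starPow u₁ (e 0)) u₃) (D.starPow u₂ (e 1))

end QuasiSplitDatum

end

/-! The star action `p ↦ F_j ↷ p(F_i ⊛, F_i)` is a linear map from `K[x, y]` to `H_θ ⋉ T(V⁻)` which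
turns multiplication by `x` into left, and multiplication by `y` into right star multiplication by
`F_i`. Because `τ(i) = i`, the torus element in the formula for `F_i ⊛ g` is trivial, and the
twisted Leibniz rule gives a three-term relation
`F_i ⊛ F_i^m F_j F_i^n = F_i^{m+1} F_j F_i^n + λ(1-Q^m) F_i^{m-1} F_j F_i^n
  + λ Q^m (1-Q^n) r F_i^m F_j F_i^{n-1}`
with `Q = q_i^2`, `r = q_i^{a_{ij}}` and `λ = c_i q_i / (q_i - q_i^{-1})^2`
(`star_F_monomial`). Moreover `F_j ⊛ F_i^n = F_j F_i^n`, because `∂_{τ(j)}^L` kills the powers of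
`F_i`. Hence the polynomials with `w_{0,0} = 1` that satisfy the corresponding recursion in `K[x, y]`
(`rescaledQHermite`) represent the monomials (`starActLin_rescaledQHermite`). Since
`4 b_i^2 λ = 1`, they are the polynomials `H_{m,n}(b_i x, b_i y; Q, r) / (2 b_i)^{m+n}` over any
extension that contains `b_i` (`rescaledQHermite_eq`).

Uniqueness needs no leading-term analysis: the recursion shows that the `w_{m,n}` span `K[x, y]`, and
their images `F_i^m F_j F_i^n` are distinct words, hence linearly independent. So the star action is
injective. -/

noncomputable section

/-! ### Rescaled bivariate `q`-Hermite polynomials -/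

section Rescaled

open MvPolynomial

variable {R : Type*} [CommRing R]

/-- The rescaled continuous `q`-Hermite polynomials in `y`, with leading coefficient `1`:
`w_{n+1} = y w_n - l (1 - q^n) w_{n-1}`. -/
def rescaledQHermiteY (l q : R) : ℕ → MvPolynomial (Fin 2) R
  | 0 => 1
  | 1 => X 1
  | n + 2 => X 1 * rescaledQHermiteY l q (n + 1)
      - C (l * (1 - q ^ (n + 1))) * rescaledQHermiteY l q n

/-- The rescaled bivariate continuous `q`-Hermite polynomials `w_{m,n}`, which satisfy
`x w_{m,n} = w_{m+1,n} + l (1 - q^m) w_{m-1,n} + l q^m (1 - q^n) r w_{m,n-1}`. For `l = (2b)⁻²` they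
are `H_{m,n}(bx, by; q, r) / (2b)^{m+n}`; in terms of `l` no square root is needed. Terms with
a negative index have coefficient zero, so the truncated subtraction `n - 1` is harmless. -/
def rescaledQHermite (l q r : R) : ℕ → ℕ → MvPolynomial (Fin 2) R
  | 0, n => rescaledQHermiteY l q n
  | 1, n => X 0 * rescaledQHermite l q r 0 n
      - C (l * (1 - q ^ n) * r) * rescaledQHermite l q r 0 (n - 1)
  | m + 2, n => X 0 * rescaledQHermite l q r (m + 1) n
      - C (l * (1 - q ^ (m + 1))) * rescaledQHermite l q r m n
      - C (l * (q ^ (m + 1) * (1 - q ^ n) * r)) * rescaledQHermite l q r (m + 1) (n - 1)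

theorem rescaledQHermiteY_succ (l q : R) (n : ℕ) :
    rescaledQHermiteY l q (n + 1) = X 1 * rescaledQHermiteY l q n
      - C (l * (1 - q ^ n)) * rescaledQHermiteY l q (n - 1) := by
  rcases n with _ | n <;> simp [rescaledQHermiteY]

theorem rescaledQHermite_succ (l q r : R) (m n : ℕ) :
    rescaledQHermite l q r (m + 1) n = X 0 * rescaledQHermite l q r m n
      - C (l * (1 - q ^ m)) * rescaledQHermite l q r (m - 1) n
      - C (l * (q ^ m * (1 - q ^ n) * r)) * rescaledQHermite l q r m (n - 1) := by
  rcases m with _ | m <;> simp [rescaledQHermite, mul_assoc]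

/-- A family that satisfies the recursions of the rescaled `q`-Hermite polynomials is equal to
them. -/
theorem eq_rescaledQHermite {l q r : R} {G : ℕ → ℕ → MvPolynomial (Fin 2) R} (h0 : G 0 0 = 1)
    (hY : ∀ n, G 0 (n + 1) = X 1 * G 0 n - C (l * (1 - q ^ n)) * G 0 (n - 1))
    (hX : ∀ m n, G (m + 1) n = X 0 * G m n - C (l * (1 - q ^ m)) * G (m - 1) n
      - C (l * (q ^ m * (1 - q ^ n) * r)) * G m (n - 1)) (m : ℕ) :
    ∀ n, G m n = rescaledQHermite l q r m n := by
  induction m using Nat.strong_induction_on with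
  | _ m ihm =>
    rcases m with _ | m
    · intro n
      induction n using Nat.strong_induction_on with
      | _ n ihn =>
        rcases n with _ | n
        · exact h0
        · rw [hY, ihn n (by omega), ihn (n - 1) (by omega)]
          exact (rescaledQHermiteY_succ l q n).symm
    · intro n
      rw [hX, ihm m (by omega), ihm m (by omega), ihm (m - 1) (by omega), rescaledQHermite_succ]

theorem map_rescaledQHermite {S : Type*} [CommRing S] (f : R →+* S) (l q r : R) (m n : ℕ) :
    map f (rescaledQHermite l q r m n) = rescaledQHermite (f l) (f q) (f r) m n := by
  refine eq_rescaledQHermite (G := fun m n => map f (rescaledQHermite l q r m n)) ?_ ?_ ?_ m n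
  · exact map_one _
  · intro n
    have h := congrArg (map f) (rescaledQHermiteY_succ l q n)
    simpa [rescaledQHermite] using h
  · intro m n
    simp [rescaledQHermite_succ l q r m n]

theorem rescaledQHermite_eq {L : Type*} [Field L] {l b : L} (hl : l * (2 * b) ^ 2 = 1) (q r : L)
    (m n : ℕ) :
    C (((2 * b) ^ (m + n))⁻¹) * bind₁ (fun k => C b * X k) (bivariateQHermite q r m n) =
      rescaledQHermite l q r m n := by
  have hb : 2 * b ≠ 0 := by
    intro h
    simp [h] at hl
  have hl' : l = ((2 * b)⁻¹) ^ 2 := by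
    rw [inv_pow]
    exact eq_inv_of_mul_eq_one_left hl
  -- `C e` with `e = (2b)⁻¹` is treated as a formal inverse of `2 C b`, so that the recursions below
  -- are linear consequences of those of `H` in a commutative ring.
  simp only [← inv_pow]
  have hCC : (C (2 * b)⁻¹ * (2 * C b) : MvPolynomial (Fin 2) L) = 1 := by
    rw [← map_ofNat C 2, ← map_mul, ← map_mul, inv_mul_cancel₀ hb, map_one]
  subst hl'
  generalize (2 * b)⁻¹ = e at hCC
  refine eq_rescaledQHermite (G := fun m n =>
    C (e ^ (m + n)) * bind₁ (fun k => C b * X k) (bivariateQHermite q r m n)) ?_ ?_ ?_ m n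
  · simp [bivariateQHermite, qHermiteY]
  · intro n
    have h := congrArg (bind₁ (fun k => C b * X k)) (qHermiteY_recursion q n)
    simp only [map_add, map_mul, bind₁_X_right, bind₁_C_right, map_ofNat] at h
    rcases n with _ | n
    · simp only [bivariateQHermite, pow_zero, sub_self, map_zero, zero_mul, mul_zero, sub_zero,
        add_zero, map_pow] at h ⊢
      linear_combination -C e * h +
        X 1 * bind₁ (fun k => C b * X k) (qHermiteY q 0) * (hCC.trans C_1.symm)
    · simp only [bivariateQHermite, zero_add, add_tsub_cancel_right, map_pow, map_mul] at h ⊢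
      linear_combination -C e ^ (n + 2) * h +
        C e ^ (n + 1) * X 1 * bind₁ (fun k => C b * X k) (qHermiteY q (n + 1)) * hCC
  · intro m n
    have h := congrArg (bind₁ (fun k => C b * X k)) (bivariateQHermite_recursion q r m n)
    simp only [map_add, map_mul, bind₁_X_right, bind₁_C_right, map_ofNat] at h
    generalize bivariateQHermite q r = H at h ⊢
    rcases m with _ | m <;> rcases n with _ | n <;>
      simp only [pow_zero, sub_self, map_zero, zero_mul, mul_zero, sub_zero, zero_add,
        add_zero, map_pow, map_mul, add_tsub_cancel_right] at h ⊢
    · linear_combination -C e * h +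
        X 0 * bind₁ (fun k => C b * X k) (H 0 0) * (hCC.trans C_1.symm)
    · linear_combination -C e ^ (n + 2) * h +
        C e ^ (n + 1) * X 0 * bind₁ (fun k => C b * X k) (H 0 (n + 1)) * hCC
    · linear_combination -C e ^ (m + 2) * h +
        C e ^ (m + 1) * X 0 * bind₁ (fun k => C b * X k) (H (m + 1) 0) * hCC
    · linear_combination -C e ^ (m + n + 3) * h +
        C e ^ (m + n + 2) * X 0 * bind₁ (fun k => C b * X k) (H (m + 1) (n + 1)) * hCC

/-- The recursions express `x w_{m,n}` and `y w_{m,n}` by other members of the family, so that the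
span of the family is an ideal; it contains `w_{0,0} = 1`. -/
theorem span_rescaledQHermite (l q r : R) :
    Submodule.span R (Set.range fun e : ℕ × ℕ => rescaledQHermite l q r e.1 e.2) = ⊤ := by
  set S := Submodule.span R (Set.range fun e : ℕ × ℕ => rescaledQHermite l q r e.1 e.2) with hS
  have hw : ∀ m n, rescaledQHermite l q r m n ∈ S := fun m n =>
    Submodule.subset_span ⟨(m, n), rfl⟩
  have hC : ∀ (k : R) {p}, p ∈ S → C k * p ∈ S := by
    intro k p hp
    rw [C_mul']
    exact S.smul_mem k hp
  have ext : ∀ i : Fin 2, (∀ m n, X i * rescaledQHermite l q r m n ∈ S) → ∀ p ∈ S, X i * p ∈ S := by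
    intro i h p hp
    induction hp using Submodule.span_induction with
    | mem p hp =>
      obtain ⟨e, rfl⟩ := hp
      exact h e.1 e.2
    | zero => simp
    | add x y _ _ hx hy => rw [mul_add]; exact S.add_mem hx hy
    | smul k x _ hx => rw [mul_smul_comm]; exact S.smul_mem k hx
  have hX : ∀ p ∈ S, X 0 * p ∈ S := by
    refine ext 0 fun m n => ?_
    have h := rescaledQHermite_succ l q r m n
    rw [sub_sub, eq_sub_iff_add_eq] at h
    rw [← h]
    exact S.add_mem (hw _ _) (S.add_mem (hC _ (hw _ _)) (hC _ (hw _ _)))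
  have hY : ∀ p ∈ S, X 1 * p ∈ S := by
    refine ext 1 fun m => ?_
    induction m using Nat.strong_induction_on with
    | _ m ih =>
      intro n
      rcases m with _ | m
      · have h := rescaledQHermiteY_succ l q n
        rw [eq_sub_iff_add_eq] at h
        change X 1 * rescaledQHermiteY l q n ∈ S
        rw [← h]
        exact S.add_mem (hw 0 _) (hC _ (hw 0 _))
      · rw [rescaledQHermite_succ, mul_sub, mul_sub, mul_left_comm, mul_left_comm (X 1) (C _),
          mul_left_comm (X 1) (C _)]
        exact S.sub_mem (S.sub_mem (hX _ (ih m (by omega) n)) (hC _ (ih (m - 1) (by omega) n)))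
          (hC _ (ih m (by omega) (n - 1)))
  rw [eq_top_iff]
  intro p _
  induction p using MvPolynomial.induction_on with
  | C k =>
    have h := hC k (hw 0 0)
    rwa [rescaledQHermite, rescaledQHermiteY, mul_one] at h
  | add x y hx hy => exact S.add_mem (hx trivial) (hy trivial)
  | mul_X p k hp =>
    rw [mul_comm]
    fin_cases k
    · exact hX _ (hp trivial)
    · exact hY _ (hp trivial)

end Rescaled

namespace QuasiSplitDatum

variable {I K : Type*} [Fintype I] [Field K] (D : QuasiSplitDatum I K)

theorem qi_sq_ne_one (i : I) : (D.qi i : K) ^ 2 ≠ 1 := by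
  intro h
  apply D.q_ne i
  rw [mul_comm, pow_mul]
  exact Units.ext (by simpa [qi] using h)

theorem qi_sub_inv_ne_zero (i : I) : (D.qi i : K) - (D.qi i : K)⁻¹ ≠ 0 := by
  intro h
  apply D.qi_sq_ne_one i
  rw [sub_eq_zero] at h
  nth_rewrite 1 [sq, h]
  exact inv_mul_cancel₀ (Units.ne_zero _)

/-- The scalar `λ = c_i q_i / (q_i - q_i^{-1})^2`, which is `(2 b_i)⁻²`. -/
def recCoeff (i : I) : K :=
  D.c i * D.qi i / ((D.qi i : K) - (D.qi i : K)⁻¹) ^ 2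

variable [DecidableEq I]

/-! ### The star action as a linear map -/

theorem star_one (u : D.HT) : D.star u 1 = u := by
  rw [D.isStarProduct_star.H_right 1 D.Hθ.one_mem, mul_one]

theorem one_star (u : D.HT) : D.star 1 u = u := by
  rw [D.isStarProduct_star.H_left 1 D.Hθ.one_mem, one_mul]

theorem starPow_succ' (u : D.HT) (n : ℕ) : D.starPow u (n + 1) = D.star (D.starPow u n) u := by
  induction n with
  | zero => simp [starPow, star_one, one_star]
  | succ n ih =>
    conv_lhs => rw [starPow, ih, ← D.isStarProduct_star.assoc]
    rfl

/-- The star action `w ↦ u₃ ↷ w(u₁ ⊛, u₂)` as a linear map. -/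
def starActLin (u₃ u₁ u₂ : D.HT) : MvPolynomial (Fin 2) K →ₗ[K] D.HT :=
  (MvPolynomial.basisMonomials (Fin 2) K).constr K fun e =>
    D.star (D.star (D.starPow u₁ (e 0)) u₃) (D.starPow u₂ (e 1))

theorem starActLin_apply (u₃ u₁ u₂ : D.HT) (w : MvPolynomial (Fin 2) K) :
    D.starActLin u₃ u₁ u₂ w = D.starAct u₃ w u₁ u₂ := by
  rw [starActLin, Module.Basis.constr_apply]
  rfl

theorem starActLin_monomial (u₃ u₁ u₂ : D.HT) (e : Fin 2 →₀ ℕ) :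
    D.starActLin u₃ u₁ u₂ (MvPolynomial.monomial e 1) =
      D.star (D.star (D.starPow u₁ (e 0)) u₃) (D.starPow u₂ (e 1)) := by
  have h : MvPolynomial.monomial e (1 : K) = MvPolynomial.basisMonomials (Fin 2) K e := by
    rw [MvPolynomial.coe_basisMonomials]
  rw [starActLin, h, Module.Basis.constr_basis]

theorem starActLin_one (u₃ u₁ u₂ : D.HT) : D.starActLin u₃ u₁ u₂ 1 = u₃ := by
  have h := D.starActLin_monomial u₃ u₁ u₂ 0
  simpa [starPow, star_one, one_star] using h

theorem starActLin_X_zero_mul (u₃ u₁ u₂ : D.HT) (p : MvPolynomial (Fin 2) K) :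
    D.starActLin u₃ u₁ u₂ (MvPolynomial.X 0 * p) = D.star u₁ (D.starActLin u₃ u₁ u₂ p) := by
  suffices h : D.starActLin u₃ u₁ u₂ ∘ₗ LinearMap.mulLeft K (MvPolynomial.X 0) =
      D.star u₁ ∘ₗ D.starActLin u₃ u₁ u₂ from LinearMap.congr_fun h p
  refine (MvPolynomial.basisMonomials (Fin 2) K).ext fun e => ?_
  rw [MvPolynomial.coe_basisMonomials, LinearMap.comp_apply, LinearMap.comp_apply,
    LinearMap.mulLeft_apply, MvPolynomial.X, MvPolynomial.monomial_mul, one_mul,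
    starActLin_monomial, starActLin_monomial, add_comm]
  simp [starPow, D.isStarProduct_star.assoc]

theorem starActLin_X_one_mul (u₃ u₁ u₂ : D.HT) (p : MvPolynomial (Fin 2) K) :
    D.starActLin u₃ u₁ u₂ (MvPolynomial.X 1 * p) = D.star (D.starActLin u₃ u₁ u₂ p) u₂ := by
  suffices h : D.starActLin u₃ u₁ u₂ ∘ₗ LinearMap.mulLeft K (MvPolynomial.X 1) =
      D.star.flip u₂ ∘ₗ D.starActLin u₃ u₁ u₂ from LinearMap.congr_fun h p
  refine (MvPolynomial.basisMonomials (Fin 2) K).ext fun e => ?_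
  rw [MvPolynomial.coe_basisMonomials, LinearMap.comp_apply, LinearMap.comp_apply,
    LinearMap.mulLeft_apply, MvPolynomial.X, MvPolynomial.monomial_mul, one_mul,
    starActLin_monomial, starActLin_monomial, add_comm]
  simp [starPow_succ', D.isStarProduct_star.assoc]

/-! ### Star products with the monomials `F_i^m F_j F_i^n` -/

theorem qpow_form (i j : I) :
    D.qpow (D.form (simpleRoot i) (simpleRoot j)) = ((D.qi i ^ D.a i j : Kˣ) : K) := by
  rw [form_simpleRoot, qpow, zpow_mul, zpow_natCast]
  rfl

theorem qpow_form_self (i : I) :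
    D.qpow (D.form (simpleRoot i) (simpleRoot i)) = (D.qi i : K) ^ 2 := by
  rw [qpow_form, D.a_diag]
  norm_cast

/-- The structure constant of `F_i ⊛ -`, divided by the denominator `1 - q_i^2` of the `q`-integers
in `derL_pow`. -/
theorem starCoeff_div {i : I} (hi : D.τ i = i) :
    D.starCoeff i / (1 - (D.qi i : K) ^ 2) = -D.recCoeff i := by
  have h1 := D.qi_sq_ne_one i
  have h2 := D.qi_sub_inv_ne_zero i
  have h3 : (D.qi i : K) ≠ 0 := Units.ne_zero _
  rw [starCoeff, recCoeff, hi, qpow_form_self]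
  have h4 : 1 - (D.qi i : K) ^ 2 = -((D.qi i : K) - (D.qi i : K)⁻¹) * D.qi i := by
    field_simp
    ring
  rw [h4]
  generalize (D.qi i : K) - (D.qi i : K)⁻¹ = x at *
  field_simp

theorem star_F_ofT {i : I} (hi : D.τ i = i) (g : FreeAlgebra K I) :
    D.star (D.F i) (D.ofT g) =
      D.ofT (FreeAlgebra.ι K i * g - D.starCoeff i • D.derL i g) := by
  have e : D.kTwist i = 1 := by
    have e0 : (⟨simpleRoot i - simpleRoot (D.τ i), AddSubgroup.subset_closure ⟨i, rfl⟩⟩ : D.Qθ)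
        = 0 := Subtype.ext (by simp [hi])
    rw [kTwist, e0]
    rfl
  rw [D.isStarProduct_star.F_left, e, inv_one, ofK_one, one_mul, hi, map_sub, map_mul, map_smul]
  rfl

theorem scale_pow_ι (i : I) (m : ℕ) :
    D.scale (simpleRoot i) (FreeAlgebra.ι K i ^ m) =
      ((D.qi i : K) ^ 2) ^ m • FreeAlgebra.ι K i ^ m := by
  rw [map_pow, scale_ι, smul_pow, qpow_form_self]

theorem derL_pow (i : I) (m : ℕ) :
    D.derL i (FreeAlgebra.ι K i ^ m) =
      ((1 - ((D.qi i : K) ^ 2) ^ m) / (1 - (D.qi i : K) ^ 2)) • FreeAlgebra.ι K i ^ (m - 1) := by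
  have h1 : 1 - (D.qi i : K) ^ 2 ≠ 0 := sub_ne_zero.2 (D.qi_sq_ne_one i).symm
  induction m with
  | zero => simp [derL_one]
  | succ m ih =>
    rw [pow_succ', derL_mul, ih, derL_ι, if_pos rfl, one_mul, scale_ι, qpow_form_self]
    rcases m with _ | m
    · simp [h1]
    · simp only [add_tsub_cancel_right, smul_mul_smul_comm, ← pow_succ']
      nth_rewrite 1 [← one_smul K (FreeAlgebra.ι K i ^ (m + 1))]
      rw [← add_smul]
      congr 1
      field_simp
      ring

theorem derL_pow_of_ne {i k : I} (h : k ≠ i) (n : ℕ) :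
    D.derL k (FreeAlgebra.ι K i ^ n) = 0 := by
  induction n with
  | zero => simp [derL_one]
  | succ n ih => rw [pow_succ, derL_mul, ih, derL_ι, if_neg h, zero_mul, mul_zero, add_zero]

theorem derL_monomial {i j : I} (hij : i ≠ j) (m n : ℕ) :
    D.derL i (FreeAlgebra.ι K i ^ m * FreeAlgebra.ι K j * FreeAlgebra.ι K i ^ n) =
      (1 - (D.qi i : K) ^ 2)⁻¹ • ((1 - ((D.qi i : K) ^ 2) ^ m) •
          (FreeAlgebra.ι K i ^ (m - 1) * FreeAlgebra.ι K j * FreeAlgebra.ι K i ^ n) +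
        (((D.qi i : K) ^ 2) ^ m * (1 - ((D.qi i : K) ^ 2) ^ n) * ((D.qi i ^ D.a i j : Kˣ) : K)) •
          (FreeAlgebra.ι K i ^ m * FreeAlgebra.ι K j * FreeAlgebra.ι K i ^ (n - 1))) := by
  rw [derL_mul, derL_mul, derL_ι, if_neg hij, mul_zero, add_zero, map_mul, scale_pow_ι, scale_ι,
    derL_pow, derL_pow, qpow_form]
  simp only [smul_mul_assoc, mul_smul_comm, smul_smul, smul_add]
  congr 2 <;> ring

theorem star_F_monomial {i j : I} (hi : D.τ i = i) (hij : i ≠ j) (m n : ℕ) :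
    D.star (D.F i) (D.F i ^ m * D.F j * D.F i ^ n) =
      D.F i ^ (m + 1) * D.F j * D.F i ^ n +
        (D.recCoeff i * (1 - ((D.qi i : K) ^ 2) ^ m)) •
          (D.F i ^ (m - 1) * D.F j * D.F i ^ n) +
        (D.recCoeff i * (((D.qi i : K) ^ 2) ^ m * (1 - ((D.qi i : K) ^ 2) ^ n) *
          ((D.qi i ^ D.a i j : Kˣ) : K))) • (D.F i ^ m * D.F j * D.F i ^ (n - 1)) := by
  have e := D.star_F_ofT hi (FreeAlgebra.ι K i ^ m * FreeAlgebra.ι K j * FreeAlgebra.ι K i ^ n)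
  rw [derL_monomial D hij, smul_smul, ← div_eq_mul_inv, starCoeff_div D hi, neg_smul,
    sub_neg_eq_add, smul_add, smul_smul, smul_smul, ← mul_assoc, ← mul_assoc, ← pow_succ',
    ← add_assoc] at e
  simpa only [map_add, map_mul, map_smul, map_pow, F] using e

theorem star_F_pow {i : I} (hi : D.τ i = i) (n : ℕ) :
    D.star (D.F i) (D.F i ^ n) = D.F i ^ (n + 1) +
      (D.recCoeff i * (1 - ((D.qi i : K) ^ 2) ^ n)) • D.F i ^ (n - 1) := by
  have e := D.star_F_ofT hi (FreeAlgebra.ι K i ^ n)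
  rw [derL_pow, smul_smul, mul_div_left_comm, starCoeff_div D hi, mul_neg, neg_smul,
    mul_comm _ (D.recCoeff i), sub_neg_eq_add, ← pow_succ'] at e
  simpa only [map_add, map_mul, map_smul, map_pow, F] using e

/-- Each ordinary power of `F_i` is a star polynomial in `F_i`, hence star commutes with `F_i`. -/
theorem star_pow_F {i : I} (hi : D.τ i = i) (n : ℕ) :
    D.star (D.F i ^ n) (D.F i) = D.star (D.F i) (D.F i ^ n) := by
  induction n using Nat.strong_induction_on with
  | _ n ih =>
    rcases n with _ | n
    · rw [pow_zero, one_star, star_one]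
    · have h := D.star_F_pow hi n
      rw [← sub_eq_iff_eq_add] at h
      rw [← h, map_sub, map_sub, LinearMap.sub_apply, D.isStarProduct_star.assoc,
        ih n (by omega), map_smul, map_smul, LinearMap.smul_apply, ih (n - 1) (by omega)]

/-- As `τ(i) = i ≠ j`, also `τ(j) ≠ i`, so `∂_{τ(j)}^L` annihilates `F_i^n`. -/
theorem star_F_pow_of_ne {i j : I} (hi : D.τ i = i) (hij : i ≠ j) (n : ℕ) :
    D.star (D.F j) (D.F i ^ n) = D.F j * D.F i ^ n := by
  have hτ : D.τ j ≠ i := fun h => hij (by rw [← hi, ← h, D.τ_invol])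
  have h := D.isStarProduct_star.F_left j (FreeAlgebra.ι K i ^ n)
  rw [derL_pow_of_ne D hτ, map_zero, mul_zero, smul_zero, sub_zero, map_pow] at h
  exact h

theorem star_F_mul_pow_F {i j : I} (hi : D.τ i = i) (hij : i ≠ j) (n : ℕ) :
    D.star (D.F j * D.F i ^ n) (D.F i) = D.F j * D.F i ^ (n + 1) +
      (D.recCoeff i * (1 - ((D.qi i : K) ^ 2) ^ n)) • (D.F j * D.F i ^ (n - 1)) := by
  rw [← D.star_F_pow_of_ne hi hij n, D.isStarProduct_star.assoc, D.star_pow_F hi, D.star_F_pow hi,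
    map_add, map_smul, D.star_F_pow_of_ne hi hij, D.star_F_pow_of_ne hi hij]

/-- The polynomial `w_{m,n}` that represents `F_i^m F_j F_i^n` as a star polynomial acting on
`F_j`. -/
abbrev monomialPoly (i j : I) (m n : ℕ) : MvPolynomial (Fin 2) K :=
  rescaledQHermite (D.recCoeff i) ((D.qi i : K) ^ 2) ((D.qi i ^ D.a i j : Kˣ) : K) m n

theorem starActLin_rescaledQHermite {i j : I} (hi : D.τ i = i) (hij : i ≠ j) (m : ℕ) :
    ∀ n, D.starActLin (D.F j) (D.F i) (D.F i) (D.monomialPoly i j m n) =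
      D.F i ^ m * D.F j * D.F i ^ n := by
  induction m using Nat.strong_induction_on with
  | _ m ihm =>
    rcases m with _ | m
    · intro n
      change D.starActLin _ _ _ (rescaledQHermiteY _ _ n) = _
      rw [pow_zero, one_mul]
      induction n using Nat.strong_induction_on with
      | _ n ihn =>
        rcases n with _ | n
        · rw [rescaledQHermiteY, starActLin_one, pow_zero, mul_one]
        · rw [rescaledQHermiteY_succ, map_sub, MvPolynomial.C_mul', map_smul,
            starActLin_X_one_mul, ihn n (by omega), ihn (n - 1) (by omega),
            D.star_F_mul_pow_F hi hij, add_sub_cancel_right]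
    · intro n
      rw [monomialPoly, rescaledQHermite_succ, map_sub, map_sub, MvPolynomial.C_mul',
        MvPolynomial.C_mul',
        map_smul, map_smul, starActLin_X_zero_mul, ihm m (by omega), ihm m (by omega),
        ihm (m - 1) (by omega), D.star_F_monomial hi hij]
      abel

/-! ### Injectivity of the star action -/

theorem ofT_injective : Function.Injective D.ofT := by
  intro f g h
  exact SkewMonoidAlgebra.single_injective 1 h

theorem linearIndependent_monomial {i j : I} (hij : i ≠ j) :
    LinearIndependent K fun e : ℕ × ℕ => D.F i ^ e.1 * D.F j * D.F i ^ e.2 := by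
  let word : ℕ × ℕ → FreeMonoid I := fun e =>
    FreeMonoid.of i ^ e.1 * FreeMonoid.of j * FreeMonoid.of i ^ e.2
  have hword : Function.Injective word := by
    rintro ⟨m, n⟩ ⟨m', n'⟩ h
    change FreeMonoid.of i ^ m * FreeMonoid.of j * FreeMonoid.of i ^ n =
      FreeMonoid.of i ^ m' * FreeMonoid.of j * FreeMonoid.of i ^ n' at h
    induction m generalizing m' with
    | zero =>
      rcases m' with _ | m'
      · have h2 := congrArg FreeMonoid.length h
        have hlen : ∀ k : ℕ, (FreeMonoid.of i ^ k).length = k := by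
          intro k
          induction k with
          | zero => simp
          | succ k ih => rw [pow_succ, FreeMonoid.length_mul, ih, FreeMonoid.length_of]
        simpa [FreeMonoid.length_mul, hlen] using h2
      · rw [pow_zero, one_mul, pow_succ', mul_assoc, mul_assoc] at h
        exact absurd (List.cons.inj h).1 hij.symm
    | succ m ih =>
      rcases m' with _ | m'
      · rw [pow_zero, one_mul, pow_succ', mul_assoc, mul_assoc] at h
        exact absurd (List.cons.inj h).1 hij
      · rw [pow_succ', pow_succ', mul_assoc, mul_assoc, mul_assoc, mul_assoc] at h
        have h2 := ih m' (by rw [mul_assoc, mul_assoc]; exact (List.cons.inj h).2)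
        simp_all
  have h1 := (FreeAlgebra.basisFreeMonoid K I).linearIndependent.comp word hword
  have h2 := h1.map_injOn D.ofT.toLinearMap D.ofT_injective.injOn
  have hbasis : ∀ v : FreeMonoid I, FreeAlgebra.basisFreeMonoid K I v =
      FreeMonoid.lift (FreeAlgebra.ι K) v := by
    intro v
    change (FreeAlgebra.equivMonoidAlgebraFreeMonoid (R := K) (X := I)).symm
      (MonoidAlgebra.single v 1) = _
    simp [FreeAlgebra.equivMonoidAlgebraFreeMonoid]
  have e : D.ofT.toLinearMap ∘ FreeAlgebra.basisFreeMonoid K I ∘ word =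
      fun e => D.F i ^ e.1 * D.F j * D.F i ^ e.2 := by
    funext e
    simp [hbasis, word, F]
  rw [e] at h2
  exact h2

/-- The star action sends a spanning family of `K[x, y]` to a linearly independent one. -/
theorem starActLin_injective {i j : I} (hi : D.τ i = i) (hij : i ≠ j) :
    Function.Injective (D.starActLin (D.F j) (D.F i) (D.F i)) := by
  rw [injective_iff_map_eq_zero]
  intro p hp
  have hspan : p ∈ Submodule.span K (Set.range fun e : ℕ × ℕ => D.monomialPoly i j e.1 e.2) := by
    rw [span_rescaledQHermite]
    trivial
  obtain ⟨x, rfl⟩ := Finsupp.mem_span_range_iff_exists_finsupp.1 hspan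
  have hx : x = 0 := by
    refine linearIndependent_iff.1 (D.linearIndependent_monomial hij) x ?_
    rw [← hp, Finsupp.linearCombination_apply, map_finsuppSum]
    simp only [map_smul, D.starActLin_rescaledQHermite hi hij]
  rw [hx, Finsupp.sum_zero_index]

end QuasiSplitDatum

end

theorem mainTheorem6 {I K : Type*} [Fintype I] [DecidableEq I] [Field K] [CharZero K]
    (D : QuasiSplitDatum I K) (i j : I) (hi : D.τ i = i) (hij : i ≠ j) :
    ∃ w : ℕ → ℕ → MvPolynomial (Fin 2) K,
      (∀ (m n : ℕ) (p : MvPolynomial (Fin 2) K),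
        D.F i ^ m * D.F j * D.F i ^ n = D.starAct (D.F j) p (D.F i) (D.F i) ↔ p = w m n) ∧
      ∀ (L : Type*) [Field L] [Algebra K L] (s b : L),
        s ^ 2 = algebraMap K L (D.c i * D.qi i) →
        b = 1 / 2 * algebraMap K L (D.qi i - (D.qi i : K)⁻¹) * s⁻¹ →
        ∀ m n : ℕ, MvPolynomial.map (algebraMap K L) (w m n) =
          MvPolynomial.C (((2 * b) ^ (m + n))⁻¹) *
            MvPolynomial.bind₁ (fun k => MvPolynomial.C b * MvPolynomial.X k)
              (bivariateQHermite (algebraMap K L ((D.qi i : K) ^ 2))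
                (algebraMap K L ((D.qi i ^ D.a i j : Kˣ) : K)) m n) := by
  refine ⟨D.monomialPoly i j, fun m n p => ?_, fun L _ _ s b hs hb m n => ?_⟩
  · rw [← D.starActLin_apply, ← D.starActLin_rescaledQHermite hi hij,
      (D.starActLin_injective hi hij).eq_iff, eq_comm]
  · have : CharZero L := charZero_of_injective_algebraMap (algebraMap K L).injective
    rw [map_rescaledQHermite]
    refine (rescaledQHermite_eq ?_ _ _ m n).symm
    have hd : algebraMap K L (D.qi i - (D.qi i : K)⁻¹) ≠ 0 :=
      (map_ne_zero _).2 (D.qi_sub_inv_ne_zero i)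
    have hs0 : s ≠ 0 := by
      rintro rfl
      rw [zero_pow two_ne_zero, eq_comm, map_eq_zero] at hs
      exact mul_ne_zero (D.c i).ne_zero (D.qi i).ne_zero hs
    rw [QuasiSplitDatum.recCoeff, map_div₀, map_pow, ← hs, hb]
    generalize algebraMap K L (D.qi i - (D.qi i : K)⁻¹) = x at hd
    field_simp
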